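/- An entire function $f$ is said to have exponential type at most $\sigma$ if for every $\epsilon>0$ there is a constant $A$ with $|f(z)|\le A e^{(\sigma+\epsilon)|z|}$ for all $z\in\mathbb{C}$. Let $$\|f\|_{BMO}=\sup_{I}\frac{1}{|I|}\int_{I}\Big|f(t)-\frac{1}{|I|}\int_{I}f(s)\,ds\Big|\,dt,$$ where the supremum runs over all bounded intervals $I\subset\mathbb{R}$ of positive length. For $b>0$, let $PW_b^{\star}$ be the vector space of all entire functions $f$ of exponential type at most $\pi b$ whose restriction to $\mathbb{R}$ satisfies $\|f\|_{BMO}<\infty$, and for $c\in\mathbb{C}$ put $\|f\|_{BMO,c}=|f(c)|+\|f\|_{BMO}$. Then the following statements hold. (I) For each $f\in PW_b^{\star}$ and each $c\in\mathbb{R}$, the function $x\mapsto f(x+ic)$ is uniformly Lipschitz continuous on $\mathbb{R}$, i.e. there is a finite $K$ with $|f(x+ic)-f(y+ic)|\le K|x-y|$ for all $x,y\in\mathbb{R}$. (II) For any fixed $c,c'\in\mathbb{C}$, the norms $\|\cdot\|_{BMO,c}$ and $\|\cdot\|_{BMO,c'}$ are equivalent on $PW_b^{\star}$: there is a constant $C=C(b,c,c')<\infty$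 such that $\|f\|_{BMO,c}\le C\|f\|_{BMO,c'}$ and $\|f\|_{BMO,c'}\le C\|f\|_{BMO,c}$ for all $f\in PW_b^{\star}$. (III) For any given $z\in\mathbb{C}$, the point evaluation functional $f\mapsto f(z)$ is bounded on $PW_b^{\star}$: for every $c\in\mathbb{C}$ there is a constant $C=C(b,c,z)<\infty$ such that $|f(z)|\le C\|f\|_{BMO,c}$ for all $f\in PW_b^{\star}$. (IV) There is a constant $C=C(b)<\infty$ such that $\|f'\|_{L^{\infty}(\mathbb{R})}\le C\|f\|_{BMO}$ for all $f\in PW_b^{\star}$. -/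

import Mathlib

open MeasureTheory
open scoped ENNReal NNReal

noncomputable section

namespace BandlimitedBMO

/-- The exponents `β` for which `f` is entire with `|f(z)| ≤ C e^{β|z|}` on `ℂ` for some `C`. -/
def growthExponents (f : ℂ → ℂ) : Set ℝ :=
  {β : ℝ | Differentiable ℂ f ∧ ∃ C : ℝ, ∀ z : ℂ, ‖f z‖ ≤ C * Real.exp (β * ‖z‖)}

/-- The exponential type of `f`: the infimum of the growth exponents, in the extended reals.
It is `⊤` if `f` is not entire or not of exponential type. -/
def expType (f : ℂ → ℂ) : EReal :=
  sInf ((fun β : ℝ => (β : EReal)) '' growthExponents f)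

/-- The mean oscillation over `[a, b]` of a (locally integrable) function `g` on the real line. -/
def meanOsc (g : ℝ → ℂ) (a b : ℝ) : ℝ≥0∞ :=
  (∫⁻ t in Set.Icc a b, ‖g t - ⨍ s in Set.Icc a b, g s‖ₑ) / ENNReal.ofReal (b - a)

/-- The BMO seminorm of a (locally integrable) function `g` on the real line, possibly infinite. -/
def bmoSeminorm (g : ℝ → ℂ) : ℝ≥0∞ :=
  ⨆ (a : ℝ) (b : ℝ) (_ : a < b), meanOsc g a b

/-- The BMO seminorm of the restriction of `f : ℂ → ℂ` to the real line. -/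
def bmo (f : ℂ → ℂ) : ℝ≥0∞ := bmoSeminorm fun x : ℝ => f x

/-- `|f(c)| + ‖f‖_BMO`. -/
def bmoNormAt (c : ℂ) (f : ℂ → ℂ) : ℝ≥0∞ := ‖f c‖ₑ + bmo f

lemma expType_le_iff (f : ℂ → ℂ) (σ : ℝ) :
    expType f ≤ σ ↔ ∀ τ : ℝ, σ < τ → τ ∈ growthExponents f := by
  constructor
  · intro h τ hτ
    have h1 : expType f < (τ : EReal) := lt_of_le_of_lt h (by exact_mod_cast hτ)
    obtain ⟨_, ⟨β, ⟨hd, C, hC⟩, rfl⟩, hβ⟩ := sInf_lt_iff.1 h1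
    have hβτ : β < τ := EReal.coe_lt_coe_iff.1 hβ
    refine ⟨hd, C, fun z => (hC z).trans ?_⟩
    have hC0 : 0 ≤ C := by
      have := (norm_nonneg _).trans (hC 0)
      simpa using this
    gcongr
  · intro h
    refine le_of_forall_gt_imp_ge_of_dense fun x hx => ?_
    obtain ⟨τ, h1, h2⟩ := EReal.lt_iff_exists_real_btwn.1 hx
    have h3 : (τ : EReal) ∈ (fun β : ℝ => (β : EReal)) '' growthExponents f :=
      ⟨τ, h τ (EReal.coe_lt_coe_iff.1 h1), rfl⟩
    exact (sInf_le h3).trans h2.le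

lemma expType_add_le {f g : ℂ → ℂ} {σ : ℝ} (hf : expType f ≤ σ) (hg : expType g ≤ σ) :
    expType (f + g) ≤ σ := by
  rw [expType_le_iff] at *
  intro τ hτ
  obtain ⟨hf, C, hC⟩ := hf τ hτ
  obtain ⟨hg, D, hD⟩ := hg τ hτ
  refine ⟨hf.add hg, C + D, fun z => ?_⟩
  rw [add_mul]
  exact (norm_add_le _ _).trans (add_le_add (hC z) (hD z))

lemma expType_smul_le {f : ℂ → ℂ} {σ : ℝ} (k : ℂ) (hf : expType f ≤ σ) :
    expType (k • f) ≤ σ := by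
  rw [expType_le_iff] at *
  intro τ hτ
  obtain ⟨hf, C, hC⟩ := hf τ hτ
  refine ⟨hf.const_smul k, ‖k‖ * C, fun z => ?_⟩
  rw [mul_assoc, Pi.smul_apply, norm_smul]
  exact mul_le_mul_of_nonneg_left (hC z) (norm_nonneg _)

lemma expType_zero_le (σ : ℝ) : expType 0 ≤ σ := by
  rw [expType_le_iff]
  exact fun τ _ => ⟨differentiable_const _, 0, fun z => by simp⟩

lemma continuous_of_expType_le {f : ℂ → ℂ} {σ : ℝ} (hf : expType f ≤ σ) :
    Continuous fun x : ℝ => f x :=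
  ((expType_le_iff f σ).1 hf (σ + 1) (by linarith)).1.continuous.comp Complex.continuous_ofReal

lemma meanOsc_le_bmoSeminorm (g : ℝ → ℂ) {a b : ℝ} (hab : a < b) :
    meanOsc g a b ≤ bmoSeminorm g :=
  le_iSup_of_le a (le_iSup_of_le b (le_iSup_of_le hab le_rfl))

lemma bmoSeminorm_add_le {g h : ℝ → ℂ} (hg : Continuous g) (hh : Continuous h) :
    bmoSeminorm (g + h) ≤ bmoSeminorm g + bmoSeminorm h := by
  refine iSup_le fun a => iSup_le fun b => iSup_le fun hab => ?_
  refine le_trans ?_ (add_le_add (meanOsc_le_bmoSeminorm g hab) (meanOsc_le_bmoSeminorm h hab))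
  have ig : IntegrableOn g (Set.Icc a b) := hg.continuousOn.integrableOn_Icc
  have ih : IntegrableOn h (Set.Icc a b) := hh.continuousOn.integrableOn_Icc
  have key : ⨍ s in Set.Icc a b, (g + h) s
      = (⨍ s in Set.Icc a b, g s) + ⨍ s in Set.Icc a b, h s := by
    simp only [setAverage_eq, Pi.add_apply]
    rw [integral_add ig ih, smul_add]
  simp only [meanOsc, key]
  rw [← ENNReal.add_div, ← lintegral_add_left (by fun_prop)]
  gcongr with t
  rw [Pi.add_apply, add_sub_add_comm]
  exact enorm_add_le _ _

lemma bmoSeminorm_smul_le (k : ℂ) (g : ℝ → ℂ) :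
    bmoSeminorm (k • g) ≤ ‖k‖ₑ * bmoSeminorm g := by
  refine iSup_le fun a => iSup_le fun b => iSup_le fun hab => ?_
  refine le_trans (le_of_eq ?_) (mul_le_mul_right (meanOsc_le_bmoSeminorm g hab) _)
  have key : ⨍ s in Set.Icc a b, (k • g) s = k • ⨍ s in Set.Icc a b, g s := by
    simp only [setAverage_eq, Pi.smul_apply]
    rw [integral_smul, smul_comm]
  simp only [meanOsc, key]
  simp only [Pi.smul_apply, ← smul_sub, enorm_smul]
  rw [lintegral_const_mul' _ _ (by simp), mul_div_assoc]

/-- The space `PW_b^⋆` of entire functions of exponential type at most `π b` whose restriction to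
the real line has finite BMO seminorm. As `|f(c)|` is finite for each `c`, the latter is the same
as finiteness of `|f(c)| + ‖f‖_BMO`, for any `c`. -/
def PWStar (b : ℝ) : Submodule ℂ (ℂ → ℂ) where
  carrier := {f | expType f ≤ ((Real.pi * b : ℝ) : EReal) ∧ bmo f < ∞}
  add_mem' {f g} hf hg := ⟨expType_add_le hf.1 hg.1,
    (bmoSeminorm_add_le (continuous_of_expType_le hf.1) (continuous_of_expType_le hg.1)).trans_lt
      (ENNReal.add_lt_top.2 ⟨hf.2, hg.2⟩)⟩
  zero_mem' := ⟨expType_zero_le _, by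
    simp [bmo, bmoSeminorm, meanOsc]⟩
  smul_mem' k f hf := ⟨expType_smul_le k hf.1,
    (bmoSeminorm_smul_le k _).trans_lt (ENNReal.mul_lt_top (by simp) hf.2)⟩

/-- The point evaluation functional `f ↦ f(z)` on `PW_b^⋆`. -/
def evalAt (b : ℝ) (z : ℂ) : PWStar b →ₗ[ℂ] ℂ :=
  (LinearMap.proj z).comp (PWStar b).subtype

end BandlimitedBMO

end

/-!
Fix a real point `x₀` and let `G` be the primitive, vanishing at `x₀`, of `f - m`, where `m` is the
mean of `f` over `[x₀ - 1, x₀ + 1]`. Comparing means over nested intervals shows that `G` grows at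
most quadratically on the real line, with a constant that only involves `‖f‖_BMO`, while `G` has no
larger exponential type than `f`. By Phragmén–Lindelöf the quadratic bound extends to horizontal
strips, and Cauchy's estimate for `G'' = f'` on the line `re z = x₀` bounds `f'` in strips by a
multiple of `‖f‖_BMO`. All four statements follow from this bound and the mean value inequality.
-/

namespace BandlimitedBMO

open Complex Filter Set
open scoped Topology

section PhragmenLindelof

variable {E : Type*} [NormedAddCommGroup E] [NormedSpace ℂ E] {f : ℂ → E} {A M τ : ℝ}

theorem norm_le_of_bounded_on_real_of_bounded_on_imaginary_ray
    (hd : DiffContOnCl ℂ f {z | 0 < z.im})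
    (hexp : ∃ c < (2 : ℝ), ∃ B, f =O[Bornology.cobounded ℂ ⊓ 𝓟 {z | 0 < z.im}]
      fun z ↦ Real.exp (B * ‖z‖ ^ c))
    (him : IsBoundedUnder (· ≤ ·) atTop fun y : ℝ ↦ ‖f (I * y)‖) (hM : ∀ x : ℝ, ‖f x‖ ≤ M)
    {z : ℂ} (hz : 0 ≤ z.im) : ‖f z‖ ≤ M := by
  have hrot : MapsTo (fun u : ℂ ↦ I * u) {u | 0 < u.re} {z | 0 < z.im} := fun u hu ↦ by
    simpa using hu
  have rotated_exp : ∃ c < (2 : ℝ), ∃ B,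
      (fun u ↦ f (I * u)) =O[Bornology.cobounded ℂ ⊓ 𝓟 {u | 0 < u.re}]
        fun u ↦ Real.exp (B * ‖u‖ ^ c) := by
    obtain ⟨c, hc, B, hB⟩ := hexp
    have htendsto : Tendsto (fun u : ℂ ↦ I * u) (Bornology.cobounded ℂ ⊓ 𝓟 {u | 0 < u.re})
        (Bornology.cobounded ℂ ⊓ 𝓟 {z | 0 < z.im}) :=
      (tendsto_mul_left_cobounded I_ne_zero).inf (tendsto_principal_principal.2 hrot)
    exact ⟨c, hc, B, by simpa [Function.comp_def] using hB.comp_tendsto htendsto⟩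
  have rotated_im (x : ℝ) : ‖f (I * (x * I))‖ ≤ M := by
    have : I * (x * I) = ((-x : ℝ) : ℂ) := by
      push_cast
      linear_combination (x : ℂ) * I_mul_I
    rw [this]
    exact hM (-x)
  have rotated_diff : DiffContOnCl ℂ (fun u ↦ f (I * u)) {u | 0 < u.re} :=
    hd.comp (Differentiable.diffContOnCl (by fun_prop)) hrot
  have key : ‖f (I * (-I * z))‖ ≤ M := PhragmenLindelof.right_half_plane_of_bounded_on_real
    (f := fun u ↦ f (I * u)) rotated_diff rotated_exp him rotated_im (by simpa using hz)
  rwa [show I * (-I * z) = z by linear_combination (-z) * I_mul_I] at key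

theorem norm_le_mul_exp_im_of_bounded_on_real (hd : DiffContOnCl ℂ f {z | 0 < z.im})
    (hA : ∀ z : ℂ, 0 ≤ z.im → ‖f z‖ ≤ A * Real.exp (τ * ‖z‖)) (hM : ∀ x : ℝ, ‖f x‖ ≤ M)
    {z : ℂ} (hz : 0 ≤ z.im) : ‖f z‖ ≤ M * Real.exp (τ * z.im) := by
  set φ : ℂ → E := fun u ↦ exp (τ * I * u) • f u
  have norm_φ (u : ℂ) : ‖φ u‖ = Real.exp (-(τ * u.im)) * ‖f u‖ := by
    simp [φ, norm_smul, norm_exp]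
  have norm_φ_le {u : ℂ} (hu : 0 ≤ u.im) :
      ‖φ u‖ ≤ A * (Real.exp (-(τ * u.im)) * Real.exp (τ * ‖u‖)) := by
    rw [norm_φ, mul_left_comm]
    gcongr
    exact hA u hu
  have φ_exp : φ =O[Bornology.cobounded ℂ ⊓ 𝓟 {u | 0 < u.im}]
      fun u ↦ Real.exp (2 * |τ| * ‖u‖ ^ (1 : ℝ)) := by
    have hA0 : 0 ≤ A := by simpa using (norm_nonneg _).trans (hA 0 le_rfl)
    refine .of_bound A (eventually_inf_principal.2 (.of_forall fun u (hu : 0 < u.im) ↦ ?_))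
    have him : -(τ * u.im) ≤ |τ| * ‖u‖ := by
      rw [← neg_mul]
      exact mul_le_mul (neg_le_abs τ) (im_le_norm u) hu.le (abs_nonneg τ)
    have hnorm : τ * ‖u‖ ≤ |τ| * ‖u‖ := by
      gcongr
      exact le_abs_self τ
    rw [Real.rpow_one, Real.norm_eq_abs, Real.abs_exp, mul_assoc, two_mul, Real.exp_add]
    grw [norm_φ_le hu.le, him, hnorm]
  have φ_im : IsBoundedUnder (· ≤ ·) atTop fun y : ℝ ↦ ‖φ (I * y)‖ := by
    refine isBoundedUnder_of_eventually_le (a := A) ?_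
    filter_upwards [eventually_ge_atTop 0] with y hy
    refine (norm_φ_le (by simpa using hy)).trans_eq ?_
    simp [← Real.exp_add, abs_of_nonneg hy]
  have φ_real (x : ℝ) : ‖φ x‖ ≤ M := by
    rw [norm_φ]
    simpa using hM x
  have key : ‖φ z‖ ≤ M := norm_le_of_bounded_on_real_of_bounded_on_imaginary_ray
    ((Differentiable.diffContOnCl (by fun_prop)).smul hd) ⟨1, one_lt_two, _, φ_exp⟩ φ_im φ_real hz
  rwa [norm_φ, Real.exp_neg, inv_mul_le_iff₀ (Real.exp_pos _), mul_comm] at key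

/-- The pole `w` lies outside the closed half plane, so that dividing by `(z - w) ^ n` reduces
polynomial growth to boundedness. -/
theorem norm_le_mul_pow_mul_exp_im (hd : DiffContOnCl ℂ f {z | 0 < z.im})
    (hA : ∀ z : ℂ, 0 ≤ z.im → ‖f z‖ ≤ A * Real.exp (τ * ‖z‖)) {w : ℂ} (hw : w.im < 0) {n : ℕ}
    (hM : ∀ x : ℝ, ‖f x‖ ≤ M * ‖(x : ℂ) - w‖ ^ n) {z : ℂ} (hz : 0 ≤ z.im) :
    ‖f z‖ ≤ M * ‖z - w‖ ^ n * Real.exp (τ * z.im) := by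
  have hδ : 0 < -w.im := neg_pos.2 hw
  have le_norm_sub {u : ℂ} (hu : 0 ≤ u.im) : -w.im ≤ ‖u - w‖ := by
    grw [← im_le_norm (u - w), sub_im, ← hu, zero_sub]
  have norm_sub_pos {u : ℂ} (hu : 0 ≤ u.im) : 0 < ‖u - w‖ := hδ.trans_le (le_norm_sub hu)
  have sub_pow_ne_zero {u : ℂ} (hu : 0 ≤ u.im) : (u - w) ^ n ≠ 0 :=
    pow_ne_zero n (norm_pos_iff.1 (norm_sub_pos hu))
  have norm_quotient (u : ℂ) : ‖((u - w) ^ n)⁻¹ • f u‖ = ‖f u‖ / ‖u - w‖ ^ n := by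
    rw [norm_smul, norm_inv, norm_pow, inv_mul_eq_div]
  have quotient_diffContOnCl :
      DiffContOnCl ℂ (fun u ↦ ((u - w) ^ n)⁻¹ • f u) {u | 0 < u.im} := by
    refine ((Differentiable.diffContOnCl (by fun_prop)).inv fun u hu ↦ ?_).smul hd
    rw [closure_setOfPred_lt_im] at hu
    exact sub_pow_ne_zero hu
  have quotient_exp_growth (u : ℂ) (hu : 0 ≤ u.im) :
      ‖((u - w) ^ n)⁻¹ • f u‖ ≤ A / (-w.im) ^ n * Real.exp (τ * ‖u‖) := by
    have hAu : 0 ≤ A * Real.exp (τ * ‖u‖) := (norm_nonneg _).trans (hA u hu)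
    rw [norm_quotient, div_mul_eq_mul_div]
    grw [hA u hu, ← le_norm_sub hu]
  have quotient_bounded_on_real (x : ℝ) : ‖((x - w) ^ n)⁻¹ • f x‖ ≤ M := by
    rw [norm_quotient, div_le_iff₀ (pow_pos (norm_sub_pos (by simp)) n)]
    exact hM x
  have key := norm_le_mul_exp_im_of_bounded_on_real quotient_diffContOnCl quotient_exp_growth
    quotient_bounded_on_real hz
  rw [norm_quotient, div_le_iff₀ (pow_pos (norm_sub_pos hz) n)] at key
  exact key.trans_eq (by ring)

end PhragmenLindelof

section ExpType

variable {f : ℂ → ℂ} {σ : ℝ}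

lemma differentiable_of_expType_le (hf : expType f ≤ σ) : Differentiable ℂ f :=
  ((expType_le_iff f σ).1 hf (σ + 1) (lt_add_one σ)).1

lemma expType_const_le (hσ : 0 ≤ σ) (m : ℂ) : expType (fun _ ↦ m) ≤ σ := by
  rw [expType_le_iff]
  refine fun τ hτ ↦ ⟨differentiable_const m, ‖m‖, fun z ↦ ?_⟩
  exact le_mul_of_one_le_right (norm_nonneg m)
    (Real.one_le_exp (mul_nonneg (hσ.trans hτ.le) (norm_nonneg z)))

lemma expType_comp_neg_le (hf : expType f ≤ σ) : expType (fun z ↦ f (-z)) ≤ σ := by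
  rw [expType_le_iff] at *
  intro τ hτ
  obtain ⟨hd, A, hA⟩ := hf τ hτ
  exact ⟨hd.comp differentiable_neg, A, fun z ↦ by simpa using hA (-z)⟩

theorem expType_le_of_expType_deriv_le (hd : Differentiable ℂ f) (hσ : 0 ≤ σ)
    (hf : expType (deriv f) ≤ σ) : expType f ≤ σ := by
  rw [expType_le_iff] at *
  intro τ hτ
  obtain ⟨ρ, hσρ, hρτ⟩ := exists_between hτ
  obtain ⟨-, A, hA⟩ := hf ρ hσρ
  have hρ : 0 ≤ ρ := hσ.trans hσρ.le
  have hδ : 0 < τ - ρ := sub_pos.2 hρτ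
  have hA0 : 0 ≤ A := by simpa using (norm_nonneg _).trans (hA 0)
  refine ⟨hd, ‖f 0‖ + A / (τ - ρ), fun z ↦ ?_⟩
  have mean_value : ‖f z - f 0‖ ≤ A * Real.exp (ρ * ‖z‖) * ‖z‖ := by
    have hderiv : ∀ w ∈ Metric.closedBall (0 : ℂ) ‖z‖, ‖deriv f w‖ ≤ A * Real.exp (ρ * ‖z‖) := by
      intro w hw
      grw [hA w, mem_closedBall_zero_iff.1 hw]
    simpa using (convex_closedBall (0 : ℂ) ‖z‖).norm_image_sub_le_of_norm_deriv_le
      (fun w _ ↦ hd w) hderiv (x := 0) (y := z) (by simp) (by simp)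
  have norm_le : ‖z‖ ≤ Real.exp ((τ - ρ) * ‖z‖) / (τ - ρ) := by
    rw [le_div_iff₀' hδ]
    linarith [Real.add_one_le_exp ((τ - ρ) * ‖z‖)]
  have one_le : 1 ≤ Real.exp (τ * ‖z‖) :=
    Real.one_le_exp (mul_nonneg (hρ.trans hρτ.le) (norm_nonneg z))
  calc ‖f z‖ ≤ ‖f 0‖ + ‖f z - f 0‖ := norm_le_norm_add_norm_sub' _ _
    _ ≤ ‖f 0‖ * Real.exp (τ * ‖z‖)
        + A * Real.exp (ρ * ‖z‖) * (Real.exp ((τ - ρ) * ‖z‖) / (τ - ρ)) := by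
      refine add_le_add (le_mul_of_one_le_right (norm_nonneg _) one_le) (mean_value.trans ?_)
      gcongr
    _ = (‖f 0‖ + A / (τ - ρ)) * Real.exp (τ * ‖z‖) := by
      rw [show τ * ‖z‖ = ρ * ‖z‖ + (τ - ρ) * ‖z‖ by ring, Real.exp_add]
      ring

lemma norm_le_mul_pow_mul_exp_im_of_expType_le (hf : expType f ≤ σ) {w : ℂ} (hw : w.im < 0)
    {M : ℝ} {n : ℕ} (hM : ∀ x : ℝ, ‖f x‖ ≤ M * ‖(x : ℂ) - w‖ ^ n) {z : ℂ} (hz : 0 ≤ z.im) :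
    ‖f z‖ ≤ M * ‖z - w‖ ^ n * Real.exp (σ * z.im) := by
  have hlim : Tendsto (fun τ ↦ M * ‖z - w‖ ^ n * Real.exp (τ * z.im)) (𝓝[>] σ)
      (𝓝 (M * ‖z - w‖ ^ n * Real.exp (σ * z.im))) :=
    (Continuous.tendsto (by fun_prop) σ).mono_left nhdsWithin_le_nhds
  refine ge_of_tendsto hlim (eventually_mem_nhdsWithin.mono fun τ hτ ↦ ?_)
  obtain ⟨hd, A, hA⟩ := (expType_le_iff f σ).1 hf τ hτ
  exact norm_le_mul_pow_mul_exp_im hd.diffContOnCl (fun u _ ↦ hA u) hw hM hz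

theorem norm_le_mul_pow_mul_exp_abs_im_of_expType_le (hf : expType f ≤ σ) {x₀ M : ℝ} {n : ℕ}
    (hM : ∀ x : ℝ, ‖f x‖ ≤ M * ‖(x - x₀ : ℂ) + I‖ ^ n) (z : ℂ) :
    ‖f z‖ ≤ M * (‖z - x₀‖ + 1) ^ n * Real.exp (σ * |z.im|) := by
  have hM0 : 0 ≤ M := by simpa using (norm_nonneg _).trans (hM x₀)
  have norm_add_I_le (u : ℂ) : ‖u + I‖ ≤ ‖u‖ + 1 := (norm_add_le u I).trans_eq (by simp)
  rcases le_total 0 z.im with hz | hz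
  · have h := norm_le_mul_pow_mul_exp_im_of_expType_le hf (w := x₀ - I) (by simp)
      (fun x ↦ by simpa only [← sub_add] using hM x) hz
    rw [← sub_add] at h
    grw [h, norm_add_I_le, abs_of_nonneg hz]
  · have norm_reflect (x : ℝ) : ‖((-x : ℝ) - x₀ : ℂ) + I‖ = ‖(x : ℂ) - (-x₀ - I)‖ := by
      rw [← norm_conj, ← norm_neg]
      congr 1
      simp
      ring
    have hM_neg (x : ℝ) : ‖f (-x)‖ ≤ M * ‖(x : ℂ) - (-x₀ - I)‖ ^ n := by
      rw [← norm_reflect, ← ofReal_neg]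
      exact hM (-x)
    have h := norm_le_mul_pow_mul_exp_im_of_expType_le (expType_comp_neg_le hf) (w := -x₀ - I)
      (by simp) hM_neg (z := -z) (by simpa using hz)
    rw [neg_neg, show -z - (-(x₀ : ℂ) - I) = -(z - x₀) + I by ring] at h
    grw [h, norm_add_I_le, norm_neg, neg_im, abs_of_nonpos hz]

end ExpType

lemma norm_average_sub_le_average_norm_sub {α E : Type*} {mα : MeasurableSpace α}
    [NormedAddCommGroup E] [NormedSpace ℝ E] [CompleteSpace E] {μ : Measure α}
    [IsFiniteMeasure μ] [NeZero μ] {g : α → E} (hg : Integrable g μ) (c : E) :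
    ‖⨍ x, g x ∂μ - c‖ ≤ ⨍ x, ‖g x - c‖ ∂μ := by
  have h : ⨍ x, g x ∂μ - c = ⨍ x, (g x - c) ∂μ := by
    conv_lhs => rw [← average_const μ c]
    simp only [average]
    rw [integral_sub (hg.to_average) (integrable_const c)]
  rw [h]
  exact norm_integral_le_integral_norm _

section MeanOscillation

variable {g : ℝ → ℂ} {a b c d : ℝ}

lemma setIntegral_norm_sub_average_le (hg : IntegrableOn g (Icc a b)) (hB : bmoSeminorm g ≠ ∞)
    (hab : a < b) :
    ∫ t in Icc a b, ‖g t - ⨍ s in Icc a b, g s‖ ≤ (b - a) * (bmoSeminorm g).toReal := by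
  have hi : IntegrableOn (fun t ↦ g t - ⨍ s in Icc a b, g s) (Icc a b) :=
    hg.sub (integrable_const _)
  have h := meanOsc_le_bmoSeminorm g hab
  rw [meanOsc, ← ofReal_integral_norm_eq_lintegral_enorm hi,
    ← ENNReal.ofReal_div_of_pos (sub_pos.2 hab), ENNReal.ofReal_le_iff_le_toReal hB,
    div_le_iff₀' (sub_pos.2 hab)] at h
  exact h

lemma norm_average_sub_average_le (hg : IntegrableOn g (Icc a b)) (hB : bmoSeminorm g ≠ ∞)
    (hac : a ≤ c) (hcd : c < d) (hdb : d ≤ b) :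
    ‖(⨍ t in Icc c d, g t) - ⨍ t in Icc a b, g t‖
      ≤ (b - a) / (d - c) * (bmoSeminorm g).toReal := by
  have hsub : Icc c d ⊆ Icc a b := Icc_subset_Icc hac hdb
  have : NeZero (volume.restrict (Icc c d)) := ⟨by simpa using hcd⟩
  set m := ⨍ t in Icc a b, g t
  calc ‖(⨍ t in Icc c d, g t) - m‖ ≤ ⨍ t in Icc c d, ‖g t - m‖ :=
        norm_average_sub_le_average_norm_sub (hg.mono_set hsub) m
    _ = (∫ t in Icc c d, ‖g t - m‖) / (d - c) := by
      rw [setAverage_eq, Real.volume_real_Icc_of_le hcd.le, smul_eq_mul, inv_mul_eq_div]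
    _ ≤ (∫ t in Icc a b, ‖g t - m‖) / (d - c) := by
      have := sub_pos.2 hcd
      gcongr ?_ / _
      exact setIntegral_mono_set (hg.sub (integrable_const m)).norm
        (.of_forall fun t ↦ norm_nonneg _) hsub.eventuallyLE
    _ ≤ (b - a) * (bmoSeminorm g).toReal / (d - c) := by
      have := sub_pos.2 hcd
      grw [setIntegral_norm_sub_average_le hg hB (by linarith)]
    _ = _ := by ring

lemma setIntegral_norm_sub_average_le_of_subinterval (hg : IntegrableOn g (Icc a b))
    (hB : bmoSeminorm g ≠ ∞) (hac : a ≤ c) (hcd : c < d) (hdb : d ≤ b) :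
    ∫ t in Icc a b, ‖g t - ⨍ s in Icc c d, g s‖
      ≤ (b - a) * (1 + (b - a) / (d - c)) * (bmoSeminorm g).toReal := by
  have hab : a < b := by linarith
  set m := ⨍ s in Icc a b, g s
  set n := ⨍ s in Icc c d, g s
  have hint (k : ℂ) : IntegrableOn (fun t ↦ ‖g t - k‖) (Icc a b) :=
    (hg.sub (integrable_const k)).norm
  calc ∫ t in Icc a b, ‖g t - n‖ ≤ ∫ t in Icc a b, (‖g t - m‖ + ‖n - m‖) := by
        refine setIntegral_mono (hint n) ((hint m).add (integrable_const _)) fun t ↦ ?_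
        simpa using norm_sub_le (g t - m) (n - m)
    _ = (∫ t in Icc a b, ‖g t - m‖) + (b - a) * ‖n - m‖ := by
      rw [integral_add (hint m) (integrable_const _), setIntegral_const,
        Real.volume_real_Icc_of_le hab.le, smul_eq_mul]
    _ ≤ (b - a) * (bmoSeminorm g).toReal
        + (b - a) * ((b - a) / (d - c) * (bmoSeminorm g).toReal) := by
      have := sub_pos.2 hab
      grw [setIntegral_norm_sub_average_le hg hB hab,
        norm_average_sub_average_le hg hB hac hcd hdb]
    _ = _ := by ring

theorem norm_integral_sub_unit_average_le (hg : LocallyIntegrable g) (hB : bmoSeminorm g ≠ ∞)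
    (x₀ x : ℝ) :
    ‖∫ t in x₀..x, (g t - ⨍ s in Icc (x₀ - 1) (x₀ + 1), g s)‖
      ≤ 4 * (bmoSeminorm g).toReal * (1 + (x - x₀) ^ 2) := by
  set m := ⨍ s in Icc (x₀ - 1) (x₀ + 1), g s
  set R := max 1 |x - x₀| with hR
  have one_le_R : 1 ≤ R := le_max_left _ _
  have abs_le_R : |x - x₀| ≤ R := le_max_right _ _
  have hint : IntegrableOn g (Icc (x₀ - R) (x₀ + R)) := hg.integrableOn_isCompact isCompact_Icc
  have hsub : uIoc x₀ x ⊆ Icc (x₀ - R) (x₀ + R) := by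
    obtain ⟨hleft, hright⟩ := abs_le.1 abs_le_R
    exact uIoc_subset_uIcc.trans
      (uIcc_subset_Icc ⟨by linarith, by linarith⟩ ⟨by linarith, by linarith⟩)
  have R_sq_le : R ^ 2 ≤ 1 + (x - x₀) ^ 2 := by
    rcases max_cases 1 |x - x₀| with ⟨h, -⟩ | ⟨h, -⟩ <;> rw [hR, h]
    · nlinarith
    · rw [sq_abs]
      linarith
  calc ‖∫ t in x₀..x, (g t - m)‖ ≤ ∫ t in uIoc x₀ x, ‖g t - m‖ :=
        intervalIntegral.norm_integral_le_integral_norm_uIoc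
    _ ≤ ∫ t in Icc (x₀ - R) (x₀ + R), ‖g t - m‖ :=
      setIntegral_mono_set (hint.sub (integrable_const m)).norm
        (.of_forall fun t ↦ norm_nonneg _) hsub.eventuallyLE
    _ ≤ (x₀ + R - (x₀ - R)) * (1 + (x₀ + R - (x₀ - R)) / (x₀ + 1 - (x₀ - 1)))
        * (bmoSeminorm g).toReal :=
      setIntegral_norm_sub_average_le_of_subinterval hint hB (by linarith) (by linarith)
        (by linarith)
    _ = 2 * (R + R ^ 2) * (bmoSeminorm g).toReal := by ring
    _ ≤ 2 * ((1 + (x - x₀) ^ 2) + (1 + (x - x₀) ^ 2)) * (bmoSeminorm g).toReal := by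
      gcongr
      nlinarith
    _ = _ := by ring

end MeanOscillation

section DerivBound

variable {f : ℂ → ℂ} {σ r : ℝ}

theorem exists_primitive_norm_le (hσ : 0 ≤ σ) (hf : expType f ≤ σ) (hB : bmo f ≠ ∞) (x₀ : ℝ) :
    ∃ (G : ℂ → ℂ) (m : ℂ), (∀ z, HasDerivAt G (f z - m) z) ∧ expType G ≤ σ ∧
      ∀ x : ℝ, ‖G x‖ ≤ 4 * (bmo f).toReal * ‖(x - x₀ : ℂ) + I‖ ^ 2 := by
  set m := ⨍ s in Icc (x₀ - 1) (x₀ + 1), f (s : ℂ)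
  have hcont : Continuous fun x : ℝ ↦ f x := continuous_of_expType_le hf
  obtain ⟨G, hG₀, hG⟩ :=
    ((differentiable_of_expType_le hf).sub_const m).isExactOn_univ.with_val_at x₀ 0
  replace hG (z : ℂ) : HasDerivAt G (f z - m) z := hG z (mem_univ z)
  refine ⟨G, m, hG, ?_, fun x ↦ ?_⟩
  · refine expType_le_of_expType_deriv_le (fun z ↦ (hG z).differentiableAt) hσ ?_
    have deriv_G : deriv G = f + fun _ ↦ -m :=
      funext fun z ↦ (hG z).deriv.trans (sub_eq_add_neg _ _)
    rw [deriv_G]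
    exact expType_add_le hf (expType_const_le hσ (-m))
  · have G_eq_integral : ∫ t in x₀..x, (f t - m) = G x := by
      simpa [hG₀] using intervalIntegral.integral_eq_sub_of_hasDerivAt
        (fun t _ ↦ (hG t).comp_ofReal) ((hcont.sub continuous_const).intervalIntegrable x₀ x)
    have norm_sq : ‖(x - x₀ : ℂ) + I‖ ^ 2 = 1 + (x - x₀) ^ 2 := by
      rw [← normSq_eq_norm_sq, normSq_apply]
      simp
      ring
    rw [← G_eq_integral, norm_sq]
    exact norm_integral_sub_unit_average_le hcont.locallyIntegrable hB x₀ x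

/-- The constant `C` in the bound `|f'| ≤ C ‖f‖_BMO` on the strip `|im z| ≤ r`, for functions of
exponential type at most `σ`. It takes values in `ℝ≥0` to serve as a Lipschitz constant. -/
noncomputable def stripDerivConst (σ r : ℝ) : ℝ≥0 :=
  8 * Real.toNNReal (2 + r) ^ 2 * Real.toNNReal (Real.exp (σ * (1 + r)))

theorem nnnorm_deriv_le_stripDerivConst_mul (hσ : 0 ≤ σ) (hf : expType f ≤ σ) (hB : bmo f ≠ ∞)
    {z : ℂ} (hz : |z.im| ≤ r) : ‖deriv f z‖₊ ≤ stripDerivConst σ r * (bmo f).toNNReal := by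
  obtain ⟨G, m, hG, hGσ, hGreal⟩ := exists_primitive_norm_le hσ hf hB z.re
  have hr : 0 ≤ r := (abs_nonneg _).trans hz
  have norm_G_le : ∀ u ∈ Metric.sphere z 1,
      ‖G u‖ ≤ 4 * (bmo f).toReal * (2 + r) ^ 2 * Real.exp (σ * (1 + r)) := by
    intro u hu
    have norm_sub : ‖u - z‖ = 1 := mem_sphere_iff_norm.1 hu
    have norm_sub_re_le : ‖u - z.re‖ ≤ 1 + r := by
      have split : u - z.re = (u - z) + z.im * I := by linear_combination -re_add_im z
      grw [split, norm_add_le, norm_sub]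
      simpa using hz
    have abs_im_le : |u.im| ≤ 1 + r := by
      simpa using (abs_im_le_norm (u - z.re)).trans norm_sub_re_le
    grw [norm_le_mul_pow_mul_exp_abs_im_of_expType_le hGσ hGreal u, norm_sub_re_le, abs_im_le]
    exact le_of_eq (by ring)
  have deriv_deriv_G : iteratedDeriv 2 G z = deriv f z := by
    rw [iteratedDeriv_succ, iteratedDeriv_one, show deriv G = fun w ↦ f w - m from
      funext fun w ↦ (hG w).deriv, deriv_sub_const]
  have cauchy := norm_iteratedDeriv_le_of_forall_mem_sphere_norm_le 2 one_pos
    (differentiable_of_expType_le hGσ).diffContOnCl norm_G_le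
  rw [deriv_deriv_G] at cauchy
  rw [← NNReal.coe_le_coe, coe_nnnorm]
  refine cauchy.trans_eq ?_
  simp only [stripDerivConst, NNReal.coe_mul, NNReal.coe_pow, NNReal.coe_ofNat,
    ENNReal.coe_toNNReal_eq_toReal, Real.coe_toNNReal _ (Real.exp_pos _).le,
    Real.coe_toNNReal (2 + r) (by linarith), Nat.factorial]
  push_cast
  ring

theorem lipschitzOnWith_strip (hσ : 0 ≤ σ) (hf : expType f ≤ σ) (hB : bmo f ≠ ∞) :
    LipschitzOnWith (stripDerivConst σ r * (bmo f).toNNReal) f (im ⁻¹' Icc (-r) r) :=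
  ((convex_Icc (-r) r).linear_preimage imLm).lipschitzOnWith_of_nnnorm_deriv_le
    (fun z _ ↦ differentiable_of_expType_le hf z)
    fun _ hz ↦ nnnorm_deriv_le_stripDerivConst_mul hσ hf hB (abs_le.2 hz)

theorem lipschitzWith_horizontal_line (hσ : 0 ≤ σ) (hf : expType f ≤ σ) (hB : bmo f ≠ ∞) (c : ℝ) :
    LipschitzWith (stripDerivConst σ |c| * (bmo f).toNNReal) fun x : ℝ ↦ f (x + c * I) := by
  have hline : LipschitzWith 1 fun x : ℝ ↦ (x + c * I : ℂ) := by
    simpa using isometry_ofReal.lipschitz.add (LipschitzWith.const (c * I))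
  have hmaps : MapsTo (fun x : ℝ ↦ (x + c * I : ℂ)) univ (im ⁻¹' Icc (-|c|) |c|) := fun x _ ↦ by
    simp [neg_abs_le, le_abs_self]
  simpa [Function.comp_def] using
    (lipschitzOnWith_strip hσ hf hB).comp (hline.lipschitzOnWith (s := univ)) hmaps

theorem enorm_le_mul_bmoNormAt (hσ : 0 ≤ σ) (hf : expType f ≤ σ) (hB : bmo f ≠ ∞) (c z : ℂ) :
    ‖f z‖ₑ ≤ (1 + stripDerivConst σ (max |z.im| |c.im|) * ‖z - c‖₊ : ℝ≥0) * bmoNormAt c f := by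
  set K := stripDerivConst σ (max |z.im| |c.im|)
  have hlip : ‖f z - f c‖ₑ ≤ K * bmo f * ‖z - c‖ₑ := by
    simpa [edist_eq_enorm_sub, ENNReal.coe_toNNReal hB] using lipschitzOnWith_strip hσ hf hB
      (abs_le.1 (le_max_left |z.im| |c.im|)) (abs_le.1 (le_max_right |z.im| |c.im|))
  calc ‖f z‖ₑ = ‖f c + (f z - f c)‖ₑ := by rw [add_sub_cancel]
    _ ≤ ‖f c‖ₑ + K * bmo f * ‖z - c‖ₑ := by grw [enorm_add_le, hlip]
    _ ≤ bmoNormAt c f + K * bmoNormAt c f * ‖z - c‖ₑ := by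
      gcongr
      exacts [le_self_add, le_add_self]
    _ = _ := by
      push_cast
      rw [enorm_eq_nnnorm]
      ring

end DerivBound

section PWStar

variable {b : ℝ}

theorem exists_enorm_le_mul_bmoNormAt (hb : 0 ≤ b) (c z : ℂ) :
    ∃ C : ℝ≥0, ∀ f ∈ PWStar b, ‖f z‖ₑ ≤ C * bmoNormAt c f :=
  ⟨_, fun _ hf ↦ enorm_le_mul_bmoNormAt (by positivity) hf.1 hf.2.ne c z⟩

theorem exists_bmoNormAt_le_mul_bmoNormAt (hb : 0 ≤ b) (c c' : ℂ) :
    ∃ C : ℝ≥0, ∀ f ∈ PWStar b, bmoNormAt c f ≤ C * bmoNormAt c' f := by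
  obtain ⟨C, hC⟩ := exists_enorm_le_mul_bmoNormAt hb c' c
  refine ⟨C + 1, fun f hf ↦ ?_⟩
  rw [ENNReal.coe_add, ENNReal.coe_one, add_mul, one_mul]
  exact add_le_add (hC f hf) le_add_self

theorem exists_eLpNorm_deriv_le_mul_bmo (hb : 0 ≤ b) :
    ∃ C : ℝ≥0, ∀ f ∈ PWStar b, eLpNorm (fun x : ℝ ↦ deriv f x) ∞ volume ≤ C * bmo f := by
  refine ⟨stripDerivConst (Real.pi * b) 0, fun f hf ↦ ?_⟩
  rw [eLpNorm_exponent_top, ← ENNReal.coe_toNNReal hf.2.ne, ← ENNReal.coe_mul]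
  exact eLpNormEssSup_le_of_ae_nnnorm_bound
    (.of_forall fun x ↦ nnnorm_deriv_le_stripDerivConst_mul (by positivity) hf.1 hf.2.ne (by simp))

end PWStar

end BandlimitedBMO

theorem mainTheorem3 (b : ℝ) (hb : 0 < b) :
    -- (I) horizontal translates are uniformly Lipschitz on the real line
    (∀ f ∈ BandlimitedBMO.PWStar b, ∀ c : ℝ, ∃ K : ℝ≥0,
      LipschitzWith K fun x : ℝ => f ((x : ℂ) + (c : ℂ) * Complex.I)) ∧
    -- (II) the norms for different base points are equivalent
    (∀ c c' : ℂ, ∃ C : ℝ≥0, ∀ f ∈ BandlimitedBMO.PWStar b,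
      BandlimitedBMO.bmoNormAt c f ≤ C * BandlimitedBMO.bmoNormAt c' f ∧
      BandlimitedBMO.bmoNormAt c' f ≤ C * BandlimitedBMO.bmoNormAt c f) ∧
    -- (III) point evaluations are bounded functionals, whichever base point norms the space
    (∀ c z : ℂ, ∃ C : ℝ≥0, ∀ f : BandlimitedBMO.PWStar b,
      ‖BandlimitedBMO.evalAt b z f‖ₑ ≤ C * BandlimitedBMO.bmoNormAt c f) ∧
    -- (IV) the sup norm on the real line of the derivative is controlled by the BMO seminorm
    (∃ C : ℝ≥0, ∀ f ∈ BandlimitedBMO.PWStar b,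
      eLpNorm (fun x : ℝ => deriv f (x : ℂ)) ∞ volume ≤ C * BandlimitedBMO.bmo f) := by
  refine ⟨fun f hf c ↦ ?lipschitz, fun c c' ↦ ?equivalence, fun c z ↦ ?evaluation, ?derivative⟩
  case lipschitz =>
    exact ⟨_, BandlimitedBMO.lipschitzWith_horizontal_line (by positivity) hf.1 hf.2.ne c⟩
  case equivalence =>
    obtain ⟨C, hC⟩ := BandlimitedBMO.exists_bmoNormAt_le_mul_bmoNormAt hb.le c c'
    obtain ⟨D, hD⟩ := BandlimitedBMO.exists_bmoNormAt_le_mul_bmoNormAt hb.le c' c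
    refine ⟨max C D, fun f hf ↦ ⟨(hC f hf).trans ?_, (hD f hf).trans ?_⟩⟩
    · grw [← le_max_left C D]
    · grw [← le_max_right C D]
  case evaluation =>
    obtain ⟨C, hC⟩ := BandlimitedBMO.exists_enorm_le_mul_bmoNormAt hb.le c z
    exact ⟨C, fun f ↦ hC f f.2⟩
  case derivative => exact BandlimitedBMO.exists_eLpNorm_deriv_le_mul_bmo hb.le
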